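/- **Setting.** Let $G$ be an undirected graph on $[N]$ ($N\ge 1$), let $\mathcal N_i$ be the neighbourhood of $i$ including $i$, and $N_i=|\mathcal N_i|$. Let $d\ge 1$, let $\mathcal X$ be the closed Euclidean unit ball of $\mathbb R^d$, and let $\mathcal U$ be the set of $U\in\mathbb R^{N\times d}$ whose rows $U_{i:}$ lie in $\mathcal X$. Every agent has a local memory. In each round $t=1,\dots,T$ an agent $i_t$ is activated; it fetches information from the agents of $\mathcal N_{i_t}$, predicts $x_t\in\mathcal X$, observes a gradient $g_t$ with $\|g_t\|_2\le 1$, and sends information to the agents of $\mathcal N_{i_t}$ (so $x_t$ is a function of the memories in $\mathcal N_{i_t}$, whose new contents are functions of their old contents and of $g_t$; all other memories are unchanged). These functions may depend on $t$, on $G$ and on the identities of the agents. The algorithm may be randomized, through initial memories that depend on a random seed (each prediction being measurable in the seed), and the activations and gradients are fixed in advance by an oblivious adversary. The regret for the linear losses $x\mapsto\langle g_t,x\rangle$ is $$R_T(U)=\mathbb E\Big[\sum_{t=1}^T \langle g_t,x_t-U_{i_t:}\rangle\Big],$$ where the expectation is over the seed only (it is superfluous for a deterministic algorithm). Put $$\sigma^2(U)=\frac1{N-1}\sum_{i=1}^N\Big\|U_{i:}-\frac1N\sum_{j=1}^N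 U_{j:}\Big\|_2^2\quad(\text{and } \sigma^2(U)=0\text{ if }N=1),$$ $$\sigma_j^2(U)=\frac{1}{2N_j(N_j-1)}\sum_{i,i'\in\mathcal N_j}\|U_{i:}-U_{i':}\|_2^2,\qquad \sigma^2_{\min}(U)=\min_j\sigma_j^2(U),\qquad \sigma^2_{\max}(U)=\max_j\sigma_j^2(U),$$ and let $\alpha_2(G)$ be the largest size of a set of vertices of $G$ whose pairwise distances (possibly infinite) are all at least $3$. **Theorem.** 1. Let $G$ be any graph on $[N]$, let $\nu\ge 0$ with $\nu^2(N-1)\le N$, let $d\ge1$, and let $T$ be such that the quantity $$B=\max\Big\{\sqrt{1+\nu^2(N-1)},\ \sqrt{\alpha_2(G)}\Big\}\,\frac{\sqrt T}{3}$$ satisfies $B\le T$ (equivalently, for $T\ge1$, $9T\ge\max\{1+\nu^2(N-1),\alpha_2(G)\}$). Then for every algorithm following the protocol on $G$ there are a sequence of activations and a sequence of gradients for which $$\sup_{U\in\mathcal U,\ \sigma^2(U)\le\nu^2}R_T(U)\ \ge\ B .$$ 2. For every even $K\ge 2$ there are $K$-regular graphs $G$ on arbitrarily large numbers $N$ of vertices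 with the following property. Let $d\ge1$, let $0\le s\le (K+1)/K$, and let $T$ be such that $\frac15\sqrt{1+Ks}\,\sqrt{NT/K}\le T$. Then for every algorithm following the protocol on $G$ there are a sequence of activations and a sequence of gradients for which $$\sup_{U\in\mathcal U,\ \sigma_{\max}^2(U)\le s}R_T(U)\ \ge\ \frac15\sqrt{1+Ks}\,\sqrt{\frac{NT}{K}} .$$ Moreover, some $U$ in this set attains $R_T(U)\ge\frac15\sqrt{1+Ks}\,\sqrt{NT/K}$, hence also $R_T(U)\ge\frac15\sqrt{1+K\sigma_{\min}^2(U)}\,\sqrt{NT/K}$. -/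

import Mathlib

open MeasureTheory

namespace CommOCO

/-- The ambient Euclidean space of decisions and gradients. -/
abbrev Vec (d : ℕ) : Type := EuclideanSpace ℝ (Fin d)

open Classical in
/-- The neighbourhood of agent `i` in the communication graph, including `i` itself. -/
noncomputable def nbhd {N : ℕ} (G : SimpleGraph (Fin N)) (i : Fin N) : Finset (Fin N) :=
  Finset.univ.filter fun j => j = i ∨ G.Adj i j

/-- A set of vertices is `k`-times independent if any two distinct vertices of it are at
graph distance at least `k + 1` (possibly infinite). -/
def IsTimesIndependent {N : ℕ} (G : SimpleGraph (Fin N)) (k : ℕ) (S : Finset (Fin N)) : Prop :=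
  ∀ i ∈ S, ∀ j ∈ S, i ≠ j → ((k + 1 : ℕ) : ℕ∞) ≤ G.edist i j

/-- The `k`-times independence number: the largest cardinality of a `k`-times independent set. -/
noncomputable def timesIndepNum {N : ℕ} (G : SimpleGraph (Fin N)) (k : ℕ) : ℕ :=
  sSup {n | ∃ S : Finset (Fin N), IsTimesIndependent G k S ∧ S.card = n}

/-- Multitask comparators: one decision in the unit ball for each agent (the rows of `U`). -/
def comparators (N d : ℕ) : Set (Fin N → Vec d) := {U | ∀ i, ‖U i‖ ≤ 1}

/-- The comparator variance. (For `N = 1` it is `0`.) -/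
noncomputable def variance {N d : ℕ} (U : Fin N → Vec d) : ℝ :=
  1 / ((N : ℝ) - 1) * ∑ i, ‖U i - (1 / (N : ℝ)) • ∑ j, U j‖ ^ 2

/-- The local task variance in the neighbourhood of agent `j`. -/
noncomputable def localVariance {N d : ℕ} (G : SimpleGraph (Fin N)) (U : Fin N → Vec d)
    (j : Fin N) : ℝ :=
  1 / (2 * ((nbhd G j).card : ℝ) * (((nbhd G j).card : ℝ) - 1)) *
    ∑ i ∈ nbhd G j, ∑ i' ∈ nbhd G j, ‖U i - U i'‖ ^ 2

/-- The smallest local task variance. -/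
noncomputable def minLocalVariance {N d : ℕ} (G : SimpleGraph (Fin N)) (U : Fin N → Vec d) : ℝ :=
  ⨅ j, localVariance G U j

/-- The largest local task variance. -/
noncomputable def maxLocalVariance {N d : ℕ} (G : SimpleGraph (Fin N)) (U : Fin N → Vec d) : ℝ :=
  ⨆ j, localVariance G U j

/-- An algorithm following the decentralized protocol on `G`, with random seed in `Ω`.
Every agent `j` has a local memory, whose initial content may depend on the seed (deterministic
algorithms ignore the seed). In round `t` with active agent `i`:
* `i` fetches information from its neighbours and predicts a point of the unit ball; the
  prediction is a function of the memories of the agents in the neighbourhood of `i`;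
* `i` observes a gradient and sends information to its neighbours; the new memories of the agents
  in the neighbourhood of `i` are functions of what `i` has access to, that is, of the old
  memories in the neighbourhood and of the gradient. All other memories are unchanged.
The functions may depend on the round number, on the identities of the agents and on `G`. -/
structure Algorithm {N : ℕ} (G : SimpleGraph (Fin N)) (d : ℕ) (Ω : Type*) where
  /-- Local memory of each agent. -/
  Memory : Fin N → Type*
  /-- Initial memories. -/
  init : Ω → (j : Fin N) → Memory j
  /-- Prediction of the active agent after the fetch step. -/
  predict : ℕ → (i : Fin N) → ((k : nbhd G i) → Memory k) → Vec d
  /-- Memories in the neighbourhood of the active agent after the send step. -/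
  update : ℕ → (i : Fin N) → ((k : nbhd G i) → Memory k) → Vec d → (k : nbhd G i) → Memory k
  /-- Predictions lie in the decision space. -/
  norm_predict_le : ∀ t i m, ‖predict t i m‖ ≤ 1

namespace Algorithm

variable {N : ℕ} {G : SimpleGraph (Fin N)} {d : ℕ} {Ω : Type*}

/-- The memories at the beginning of round `t` (rounds are numbered from `0`), when the agents
`act 0, act 1, …` are activated and the gradients `g 0, g 1, …` are observed. -/
noncomputable def memory (A : Algorithm G d Ω) (act : ℕ → Fin N) (g : ℕ → Vec d) (ω : Ω) :
    ℕ → (j : Fin N) → A.Memory j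
  | 0 => A.init ω
  | t + 1 => fun j =>
      if h : j ∈ nbhd G (act t) then
        A.update t (act t) (fun k => A.memory act g ω t k) (g t) ⟨j, h⟩
      else A.memory act g ω t j

/-- The prediction `x_t` made by the active agent in round `t`. -/
noncomputable def prediction (A : Algorithm G d Ω) (act : ℕ → Fin N) (g : ℕ → Vec d) (ω : Ω)
    (t : ℕ) : Vec d :=
  A.predict t (act t) (fun k => A.memory act g ω t k)

/-- For fixed activations and gradients, each prediction is a random variable. -/
def IsMeasurable [MeasurableSpace Ω] (A : Algorithm G d Ω) : Prop :=
  ∀ (act : ℕ → Fin N) (g : ℕ → Vec d) (t : ℕ), Measurable fun ω => A.prediction act g ω t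

/-- Multitask regret over `T` rounds against the comparator `U`, for the losses `ℓ`, when the
gradient observed in round `t` is `g t`. -/
noncomputable def regret (A : Algorithm G d Ω) (act : ℕ → Fin N) (ℓ : ℕ → Vec d → ℝ)
    (g : ℕ → Vec d) (T : ℕ) (U : Fin N → Vec d) (ω : Ω) : ℝ :=
  ∑ t ∈ Finset.range T, (ℓ t (A.prediction act g ω t) - ℓ t (U (act t)))

/-- Expected multitask regret for the gradient sequence `g`, that is, for the linear losses
`x ↦ ⟪g t, x⟫`. For a deterministic algorithm this is simply its regret. -/
noncomputable def expectedRegret [MeasurableSpace Ω] (A : Algorithm G d Ω) (P : Measure Ω)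
    (act : ℕ → Fin N) (g : ℕ → Vec d) (T : ℕ) (U : Fin N → Vec d) : ℝ :=
  ∫ ω, A.regret act (fun t x => inner ℝ (g t) x) g T U ω ∂P

end Algorithm

/-- The first lower bound, for `N` agents, variance level `ν ^ 2`, twice independence number `a`
and horizon `T`. -/
noncomputable def generalBound (N a : ℕ) (ν : ℝ) (T : ℕ) : ℝ :=
  max (Real.sqrt (1 + ν ^ 2 * ((N : ℝ) - 1))) (Real.sqrt (a : ℝ)) * (Real.sqrt (T : ℝ) / 3)

/-- The second lower bound, for a `K`-regular graph on `N` vertices, local variance level `s` and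
horizon `T`. -/
noncomputable def regularBound (N K : ℕ) (s : ℝ) (T : ℕ) : ℝ :=
  1 / 5 * Real.sqrt (1 + (K : ℝ) * s) * Real.sqrt ((N : ℝ) * (T : ℝ) / (K : ℝ))

end CommOCO

open CommOCO

universe u v

/-! All gradients are `±e` for one fixed unit vector `e`, with signs given by fair coins. A
prediction that does not depend on the coin of its own round has mean loss zero. A comparator row
`±e`, with sign opposite to the sum of the `q` signs met by its agent, gains the absolute value of
that sum, whose mean is at least `√(q/3)` (`khintchine`). Some outcome of the coins gives a regret
no smaller than the mean (`Algorithm.exists_expectedRegret_ge`), so `M` agents activated about `T /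
M` times each force a regret of order `√(M * T)`.

Two couplings of the coins are used. With independent coins, causality alone makes the predictions
uninformed, on any graph, but the rows carry different signs: `M` nonzero rows use up a variance
budget of about `M`, whence `M = ⌊ν² (N - 1)⌋`. With the same coins for all agents of a set whose
neighbourhoods are pairwise disjoint, predictions are uninformed because nothing travels between
these agents; one constant comparator of variance zero then serves them all, which yields `√α₂`.

For the regular graphs, disjoint cliques of size `K + 1` are taken, with independent coins for `⌊K
s⌋` agents in each clique. If `K s < 2`, one agent per clique suffices, and the comparator is
constant on cliques. -/

namespace CommOCO

/-! ### Rademacher sums -/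

section Rademacher

/-- The sign `±1` attached to a coin. -/
def coinSign (b : Bool) : ℝ := if b then 1 else -1

lemma coinSign_not (b : Bool) : coinSign (!b) = -coinSign b := by
  cases b <;> simp [coinSign]

lemma coinSign_sq (b : Bool) : coinSign b ^ 2 = 1 := by
  cases b <;> simp [coinSign]

lemma abs_coinSign (b : Bool) : |coinSign b| = 1 := by
  cases b <;> simp [coinSign]

/-- The coin whose sign is opposite to that of a real number. -/
noncomputable def oppositeCoin (x : ℝ) : Bool := decide (x < 0)

lemma mul_coinSign_oppositeCoin (x : ℝ) : x * coinSign (oppositeCoin x) = -|x| := by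
  by_cases h : x < 0
  · simp [oppositeCoin, coinSign, h, abs_of_neg h]
  · simp [oppositeCoin, coinSign, h, abs_of_nonneg (not_lt.mp h)]

variable {I : Type*} [DecidableEq I]

/-- Turn over coin `i`. -/
def flipCoin (i : I) (x : I → Bool) : I → Bool := Function.update x i (!x i)

lemma flipCoin_self (i : I) (x : I → Bool) : flipCoin i x i = !x i := by simp [flipCoin]

lemma flipCoin_of_ne {i j : I} (h : j ≠ i) (x : I → Bool) : flipCoin i x j = x j := by
  simp [flipCoin, h]

lemma flipCoin_involutive (i : I) : Function.Involutive (flipCoin i) := by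
  intro x
  ext j
  by_cases h : j = i
  · subst h; simp [flipCoin]
  · simp [flipCoin, h]

/-- The sum of the signs of the coins in `J`. -/
def signSum (J : Finset I) (x : I → Bool) : ℝ := ∑ i ∈ J, coinSign (x i)

lemma signSum_flipCoin {J : Finset I} {i : I} (h : i ∉ J) (x : I → Bool) :
    signSum J (flipCoin i x) = signSum J x :=
  Finset.sum_congr rfl fun j hj => by rw [flipCoin_of_ne (ne_of_mem_of_not_mem hj h)]

lemma signSum_insert {J : Finset I} {i : I} (h : i ∉ J) (x : I → Bool) :
    signSum (insert i J) x = coinSign (x i) + signSum J x := Finset.sum_insert h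

variable [Fintype I]

/-- Flipping coin `i` permutes the outcomes and changes the sign of every term. This is the only
form of independence that is needed: it gives the moments below and the zero mean loss of the
learner. -/
lemma sum_coinSign_mul_eq_zero (i : I) (F : (I → Bool) → ℝ)
    (hF : ∀ x, F (flipCoin i x) = F x) : ∑ x : I → Bool, coinSign (x i) * F x = 0 := by
  have h := Equiv.sum_comp (flipCoin_involutive i).toPerm fun x => coinSign (x i) * F x
  simp only [Function.Involutive.coe_toPerm, flipCoin_self, coinSign_not, hF, neg_mul,
    Finset.sum_neg_distrib] at h
  linarith

lemma sum_signSum_sq (J : Finset I) :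
    ∑ x : I → Bool, signSum J x ^ 2 = Fintype.card (I → Bool) * (J.card : ℝ) := by
  induction J using Finset.induction_on with
  | empty => simp [signSum]
  | insert i J hi ih =>
    have h0 := sum_coinSign_mul_eq_zero i (signSum J) (signSum_flipCoin hi)
    have h : ∀ x : I → Bool, signSum (insert i J) x ^ 2 =
        signSum J x ^ 2 + 2 * (coinSign (x i) * signSum J x) + 1 := fun x => by
      rw [signSum_insert hi]
      linear_combination coinSign_sq (x i)
    simp only [h, Finset.sum_add_distrib, ← Finset.mul_sum, ih, h0,
      Finset.card_insert_of_notMem hi, Finset.sum_const, Finset.card_univ, nsmul_eq_mul]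
    push_cast
    ring

lemma sum_signSum_pow_four (J : Finset I) :
    ∑ x : I → Bool, signSum J x ^ 4 =
      Fintype.card (I → Bool) * (3 * (J.card : ℝ) ^ 2 - 2 * J.card) := by
  induction J using Finset.induction_on with
  | empty => simp [signSum]
  | insert i J hi ih =>
    have h0 := sum_coinSign_mul_eq_zero i (signSum J) (signSum_flipCoin hi)
    have h1 := sum_coinSign_mul_eq_zero i (fun x => signSum J x ^ 3)
      (fun x => by rw [signSum_flipCoin hi])
    have h : ∀ x : I → Bool, signSum (insert i J) x ^ 4 =
        signSum J x ^ 4 + 4 * (coinSign (x i) * signSum J x ^ 3) + 6 * signSum J x ^ 2 +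
          4 * (coinSign (x i) * signSum J x) + 1 := fun x => by
      rw [signSum_insert hi]
      linear_combination (coinSign (x i) ^ 2 + 1 + 4 * coinSign (x i) * signSum J x +
        6 * signSum J x ^ 2) * coinSign_sq (x i)
    simp only [h, Finset.sum_add_distrib, ← Finset.mul_sum, ih, h0, h1, sum_signSum_sq,
      Finset.card_insert_of_notMem hi, Finset.sum_const, Finset.card_univ, nsmul_eq_mul]
    push_cast
    ring

/-- A linearized Hölder inequality, with equality at `|y| = 3 * r`: it bounds a first absolute
moment from below by the second and fourth moments. -/
lemma sq_sub_pow_four_le_abs {r : ℝ} (hr : 0 < r) (y : ℝ) :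
    27 * r ^ 2 * y ^ 2 - y ^ 4 ≤ 54 * r ^ 3 * |y| := by
  have h2 : y ^ 2 = |y| ^ 2 := (sq_abs y).symm
  have h4 : y ^ 4 = |y| ^ 4 := by rw [show y ^ 4 = (y ^ 2) ^ 2 by ring, h2]; ring
  rw [h2, h4]
  have h : 0 ≤ |y| * ((|y| - 3 * r) ^ 2 * (|y| + 6 * r)) := by positivity
  linarith [show |y| * ((|y| - 3 * r) ^ 2 * (|y| + 6 * r)) =
    54 * r ^ 3 * |y| - 27 * r ^ 2 * |y| ^ 2 + |y| ^ 4 by ring]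

/-- Khintchine's inequality with constant `1 / √3`. -/
lemma khintchine (J : Finset I) :
    Fintype.card (I → Bool) * Real.sqrt (J.card / 3) ≤ ∑ x : I → Bool, |signSum J x| := by
  rcases J.eq_empty_or_nonempty with rfl | hJ
  · simp [signSum]
  have hn : (0 : ℝ) < J.card := by exact_mod_cast hJ.card_pos
  set r := Real.sqrt (J.card / 3) with hr
  have hr0 : 0 < r := Real.sqrt_pos.mpr (by positivity)
  have hr2 : (J.card : ℝ) = 3 * r ^ 2 := by
    rw [hr, Real.sq_sqrt (by positivity)]; ring
  have h := Finset.sum_le_sum fun x (_ : x ∈ (Finset.univ : Finset (I → Bool))) =>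
    sq_sub_pow_four_le_abs hr0 (signSum J x)
  rw [Finset.sum_sub_distrib, ← Finset.mul_sum, ← Finset.mul_sum, sum_signSum_sq,
    sum_signSum_pow_four, hr2] at h
  have hC : (0 : ℝ) ≤ Fintype.card (I → Bool) := by positivity
  -- With `n = 3 r²`, the mean of the left side of `h` is `81 r⁴ - 27 r⁴ + 6 r²`, which exceeds `54
  -- r⁴`.
  have h' : 54 * r ^ 3 * (Fintype.card (I → Bool) * r) ≤
      54 * r ^ 3 * ∑ x : I → Bool, |signSum J x| := by
    nlinarith [mul_nonneg hC (sq_nonneg r)]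
  exact le_of_mul_le_mul_left h' (mul_pos (by norm_num) (pow_pos hr0 3))

/-- A lower bound for the mean absolute value of a sum of `q` independent signs. -/
noncomputable def signMeanBound (q : ℕ) : ℝ := if q = 1 then 1 else Real.sqrt (q / 3)

lemma signMeanBound_le (J : Finset I) :
    Fintype.card (I → Bool) * signMeanBound J.card ≤ ∑ x : I → Bool, |signSum J x| := by
  unfold signMeanBound
  split_ifs with h
  · obtain ⟨i, rfl⟩ := Finset.card_eq_one.mp h
    have h1 (x : I → Bool) : |signSum {i} x| = 1 := by
      rw [signSum, Finset.sum_singleton, abs_coinSign]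
    simp only [h1, Finset.sum_const, Finset.card_univ, nsmul_eq_mul]
    exact le_rfl
  · exact khintchine J

lemma signMeanBound_nonneg (q : ℕ) : 0 ≤ signMeanBound q := by
  unfold signMeanBound
  split_ifs <;> positivity

lemma div_three_le_signMeanBound_sq (q : ℕ) : (q : ℝ) / 3 ≤ signMeanBound q ^ 2 := by
  unfold signMeanBound
  split_ifs with h
  · subst h; norm_num
  · rw [Real.sq_sqrt (by positivity)]

/-- The factor `q + 1` absorbs the rounding in `q = T / M`. The constant `2 / 9` is sharp at `q =
2`; at `q = 1` the value `1 / 3` from Khintchine would be too small, which is why `signMeanBound`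
uses the exact mean there. -/
lemma two_ninths_mul_le_signMeanBound_sq {q : ℕ} (hq : 1 ≤ q) :
    2 / 9 * ((q : ℝ) + 1) ≤ signMeanBound q ^ 2 := by
  unfold signMeanBound
  split_ifs with h
  · subst h; norm_num
  · rw [Real.sq_sqrt (by positivity)]
    have : (2 : ℝ) ≤ q := by exact_mod_cast (by omega : 2 ≤ q)
    linarith

end Rademacher

/-! ### Information flow -/

namespace Algorithm

variable {N : ℕ} {G : SimpleGraph (Fin N)} {d : ℕ} {Ω : Type*}

lemma memory_congr (A : Algorithm G d Ω) (act : ℕ → Fin N) {g g' : ℕ → Vec d} (ω : Ω) (t : ℕ)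
    (h : ∀ s < t, g s = g' s) : A.memory act g ω t = A.memory act g' ω t := by
  induction t with
  | zero => rfl
  | succ t ih =>
    have ih' := ih fun s hs => h s (hs.trans (Nat.lt_succ_self t))
    funext j
    simp only [memory, ih', h t (Nat.lt_succ_self t)]

lemma prediction_congr (A : Algorithm G d Ω) (act : ℕ → Fin N) {g g' : ℕ → Vec d} (ω : Ω) (t : ℕ)
    (h : ∀ s < t, g s = g' s) : A.prediction act g ω t = A.prediction act g' ω t := by
  unfold prediction
  rw [A.memory_congr act ω t h]

/-- An activation of `i` reads only memories in the neighbourhood of `i`, and an activation with a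
disjoint neighbourhood writes none of them, so these memories evolve as a closed system driven by
the gradients of `i`. -/
lemma memory_congr_of_disjoint (A : Algorithm G d Ω) (act : ℕ → Fin N) {g g' : ℕ → Vec d} (ω : Ω)
    (i : Fin N) (t : ℕ)
    (h : ∀ s < t, (act s = i ∧ g s = g' s) ∨ Disjoint (nbhd G (act s)) (nbhd G i)) :
    ∀ j ∈ nbhd G i, A.memory act g ω t j = A.memory act g' ω t j := by
  induction t with
  | zero => exact fun _ _ => rfl
  | succ t ih =>
    intro j hj
    have ih' := ih fun s hs => h s (hs.trans (Nat.lt_succ_self t))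
    rcases h t (Nat.lt_succ_self t) with ⟨h1, h2⟩ | h1
    · have hm : (fun k : nbhd G (act t) => A.memory act g ω t k) =
          fun k : nbhd G (act t) => A.memory act g' ω t k := by
        funext k
        exact ih' k (h1 ▸ k.2)
      simp only [memory, hm, h2, ih' j hj]
    · have hj' : j ∉ nbhd G (act t) := fun hj' => Finset.disjoint_left.mp h1 hj' hj
      simp only [memory, hj', dite_false, ih' j hj]

lemma prediction_congr_of_disjoint (A : Algorithm G d Ω) (act : ℕ → Fin N) {g g' : ℕ → Vec d}
    (ω : Ω) (t : ℕ)
    (h : ∀ s < t, (act s = act t ∧ g s = g' s) ∨ Disjoint (nbhd G (act s)) (nbhd G (act t))) :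
    A.prediction act g ω t = A.prediction act g' ω t := by
  unfold prediction
  congr 1
  funext k
  exact A.memory_congr_of_disjoint act ω (act t) t h k k.2

lemma norm_prediction_le (A : Algorithm G d Ω) (act : ℕ → Fin N) (g : ℕ → Vec d) (ω : Ω) (t : ℕ) :
    ‖A.prediction act g ω t‖ ≤ 1 := A.norm_predict_le _ _ _

/-! ### Averaging over the gradients -/

variable [MeasurableSpace Ω]

/-- This makes the expected regret a genuine expectation: the integral of a non-integrable function
defaults to `0`. -/
lemma integrable_inner_prediction (A : Algorithm G d Ω) (hA : A.IsMeasurable) (P : Measure Ω)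
    [IsProbabilityMeasure P] (act : ℕ → Fin N) (g : ℕ → Vec d) (t : ℕ) :
    Integrable (fun ω => inner ℝ (g t) (A.prediction act g ω t)) P := by
  refine Integrable.of_bound ((hA act g t).const_inner).aestronglyMeasurable ‖g t‖
    (Filter.Eventually.of_forall fun ω => ?_)
  refine (norm_inner_le_norm _ _).trans ?_
  exact mul_le_of_le_one_right (norm_nonneg _) (A.norm_prediction_le act g ω t)

lemma expectedRegret_eq (A : Algorithm G d Ω) (hA : A.IsMeasurable) (P : Measure Ω)
    [IsProbabilityMeasure P] (act : ℕ → Fin N) (g : ℕ → Vec d) (T : ℕ) (U : Fin N → Vec d) :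
    A.expectedRegret P act g T U =
      ∫ ω, ∑ t ∈ Finset.range T, inner ℝ (g t) (A.prediction act g ω t) ∂P -
        ∑ t ∈ Finset.range T, inner ℝ (g t) (U (act t)) := by
  unfold expectedRegret regret
  simp only [Finset.sum_sub_distrib]
  rw [integral_sub (integrable_finsetSum _ fun t _ =>
    A.integrable_inner_prediction hA P act g t) (integrable_const _)]
  simp

/-- If the predictions are uncorrelated with the random gradients, some realization of the
gradients forces a regret that is at least the mean gain of the comparators. -/
lemma exists_expectedRegret_ge {X : Type*} [Fintype X] [Nonempty X] (A : Algorithm G d Ω)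
    (hA : A.IsMeasurable) (P : Measure Ω) [IsProbabilityMeasure P] (act : ℕ → Fin N)
    (g : X → ℕ → Vec d) (T : ℕ) (U : X → Fin N → Vec d) (r : ℝ)
    (h0 : ∀ ω, ∀ t, ∑ x, inner ℝ (g x t) (A.prediction act (g x) ω t) = 0)
    (hr : Fintype.card X * r ≤ ∑ x, -∑ t ∈ Finset.range T, inner ℝ (g x t) (U x (act t))) :
    ∃ x, r ≤ A.expectedRegret P act (g x) T (U x) := by
  -- The average over gradients vanishes for each seed separately, and a finite sum may be moved
  -- inside the integral.
  have hz : ∑ x, ∫ ω, ∑ t ∈ Finset.range T, inner ℝ (g x t) (A.prediction act (g x) ω t) ∂P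
      = 0 := by
    rw [← integral_finsetSum _ fun x _ => integrable_finsetSum _ fun t _ =>
      A.integrable_inner_prediction hA P act (g x) t]
    have : ∀ ω, ∑ x, ∑ t ∈ Finset.range T,
        inner ℝ (g x t) (A.prediction act (g x) ω t) = 0 := fun ω => by
      rw [Finset.sum_comm]
      exact Finset.sum_eq_zero fun t _ => h0 ω t
    simp [this]
  have hs : ∑ _x : X, r ≤ ∑ x, A.expectedRegret P act (g x) T (U x) := by
    simp only [A.expectedRegret_eq hA P act, Finset.sum_sub_distrib, hz, zero_sub]
    simpa [Finset.sum_neg_distrib] using hr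
  obtain ⟨x, -, hx⟩ := Finset.exists_le_of_sum_le Finset.univ_nonempty hs
  exact ⟨x, hx⟩

end Algorithm
/-! ### Round-robin adversaries -/

section RoundRobin

variable {N d q M : ℕ} {I : Type*}

/-- Activate the agents `v 0, …, v (M - 1)` cyclically, `q` times each, then agent `i₀`. -/
def roundRobin (q : ℕ) (v : Fin M → Fin N) (i₀ : Fin N) (t : ℕ) : Fin N :=
  if h : t < q * M then v (finProdFinEquiv.symm ⟨t, h⟩ : Fin q × Fin M).2 else i₀

/-- The gradients `±e`, with the sign of coin `c (k, j)` when the `j`-th agent is activated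
for the `k`-th time, and `0` after the round-robin phase. -/
noncomputable def coinGradient (c : Fin q × Fin M → I) (e : Vec d) (x : I → Bool) (t : ℕ) :
    Vec d :=
  if h : t < q * M then coinSign (x (c (finProdFinEquiv.symm ⟨t, h⟩))) • e else 0

lemma roundRobin_apply (v : Fin M → Fin N) (i₀ : Fin N) (p : Fin q × Fin M) :
    roundRobin q v i₀ (finProdFinEquiv p) = v p.2 := by
  have h : ((finProdFinEquiv p : Fin (q * M)) : ℕ) < q * M := (finProdFinEquiv p).isLt
  rw [roundRobin, dif_pos h, Fin.eta, Equiv.symm_apply_apply]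

lemma coinGradient_apply (c : Fin q × Fin M → I) (e : Vec d) (x : I → Bool)
    (p : Fin q × Fin M) :
    coinGradient c e x (finProdFinEquiv p) = coinSign (x (c p)) • e := by
  have h : ((finProdFinEquiv p : Fin (q * M)) : ℕ) < q * M := (finProdFinEquiv p).isLt
  rw [coinGradient, dif_pos h, Fin.eta, Equiv.symm_apply_apply]

lemma exists_eq_finProdFinEquiv {t : ℕ} (h : t < q * M) :
    ∃ p : Fin q × Fin M, t = finProdFinEquiv p :=
  ⟨finProdFinEquiv.symm ⟨t, h⟩, by simp only [Equiv.apply_symm_apply]⟩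

lemma norm_coinGradient_le (c : Fin q × Fin M → I) {e : Vec d} (he : ‖e‖ = 1) (x : I → Bool)
    (t : ℕ) : ‖coinGradient c e x t‖ ≤ 1 := by
  unfold coinGradient
  split_ifs
  · rw [norm_smul, Real.norm_eq_abs, abs_coinSign, he, one_mul]
  · simp

lemma coinGradient_flipCoin [DecidableEq I] (c : Fin q × Fin M → I) (e : Vec d) (x : I → Bool)
    (i : I) (p : Fin q × Fin M) (h : c p ≠ i) :
    coinGradient c e (flipCoin i x) (finProdFinEquiv p) =
      coinGradient c e x (finProdFinEquiv p) := by
  rw [coinGradient_apply, coinGradient_apply, flipCoin_of_ne h]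

lemma sum_range_inner_coinGradient (c : Fin q × Fin M → I) (e : Vec d) (x : I → Bool)
    (v : Fin M → Fin N) (i₀ : Fin N) (V : Fin N → Vec d) {T : ℕ} (hT : q * M ≤ T) :
    ∑ t ∈ Finset.range T, inner ℝ (coinGradient c e x t) (V (roundRobin q v i₀ t)) =
      ∑ p : Fin q × Fin M, coinSign (x (c p)) * inner ℝ e (V (v p.2)) := by
  rw [← Finset.sum_subset (Finset.range_subset_range.mpr hT), Finset.sum_range,
    ← finProdFinEquiv.sum_comp]
  · exact Finset.sum_congr rfl fun p _ => by
      rw [coinGradient_apply, roundRobin_apply, real_inner_smul_left]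
  · intro t _ ht
    rw [coinGradient, dif_neg (by simpa using ht), inner_zero_left]

variable {G : SimpleGraph (Fin N)} {Ω : Type*} [MeasurableSpace Ω]

/-- Common core of both adversaries, which differ only in the labelling `c` of activations by coins:
`id` for independent coins, `Prod.fst` for coins shared within a cycle. The hypothesis `hflip` says
that a prediction ignores the coin of its own round. -/
lemma Algorithm.exists_expectedRegret_roundRobin_ge [Fintype I] [DecidableEq I]
    (A : Algorithm G d Ω)
    (hA : A.IsMeasurable) (P : Measure Ω) [IsProbabilityMeasure P] (v : Fin M → Fin N)
    (i₀ : Fin N) (c : Fin q × Fin M → I) (e : Vec d) {T : ℕ} (hT : q * M ≤ T)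
    (hflip : ∀ ω x p, A.prediction (roundRobin q v i₀) (coinGradient c e (flipCoin (c p) x)) ω
        (finProdFinEquiv p) =
      A.prediction (roundRobin q v i₀) (coinGradient c e x) ω (finProdFinEquiv p))
    (U : (I → Bool) → Fin N → Vec d) (r : ℝ)
    (hr : Fintype.card (I → Bool) * r ≤
      ∑ x : I → Bool, -∑ p : Fin q × Fin M, coinSign (x (c p)) * inner ℝ e (U x (v p.2))) :
    ∃ x, r ≤ A.expectedRegret P (roundRobin q v i₀) (coinGradient c e x) T (U x) := by
  refine A.exists_expectedRegret_ge hA P _ _ T U r (fun ω t => ?_) ?_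
  · by_cases ht : t < q * M
    · obtain ⟨p, rfl⟩ := exists_eq_finProdFinEquiv ht
      simp only [coinGradient_apply, real_inner_smul_left]
      exact sum_coinSign_mul_eq_zero (c p) _ fun x => by rw [hflip]
    · exact Finset.sum_eq_zero fun x _ => by rw [coinGradient, dif_neg ht, inner_zero_left]
  · simpa only [sum_range_inner_coinGradient c e _ v i₀ _ hT] using hr

/-- Agents that face independent random gradients force a regret of order `√q` each, where `q` is
the number of their activations. -/
lemma Algorithm.exists_expectedRegret_independent_ge (A : Algorithm G d Ω)
    (hA : A.IsMeasurable) (P : Measure Ω) [IsProbabilityMeasure P] (i₀ : Fin N) {e : Vec d}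
    (he : ‖e‖ = 1) (S : Finset (Fin N)) {T : ℕ} (hT : q * S.card ≤ T)
    (U : (Fin N → Bool) → Fin N → Vec d)
    (hU : ∀ b, ∀ i ∈ S, inner ℝ e (U b i) = coinSign (b i)) :
    ∃ (act : ℕ → Fin N) (g : ℕ → Vec d) (b : Fin N → Bool), (∀ t, ‖g t‖ ≤ 1) ∧
      S.card * signMeanBound q ≤ A.expectedRegret P act g T (U b) := by
  set v := S.orderEmbOfFin rfl
  set J : Fin S.card → Finset (Fin q × Fin S.card) := fun j => Finset.univ ×ˢ {j}
  set b : (Fin q × Fin S.card → Bool) → Fin N → Bool := fun x =>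
    Function.extend v (fun j => oppositeCoin (signSum (J j) x)) fun _ => false
  have hb (x : Fin q × Fin S.card → Bool) (j : Fin S.card) :
      inner ℝ e (U (b x) (v j)) = coinSign (oppositeCoin (signSum (J j) x)) := by
    rw [hU _ _ (S.orderEmbOfFin_mem rfl j)]
    simp only [b]
    rw [v.injective.extend_apply]
  have hflip : ∀ ω (x : Fin q × Fin S.card → Bool) (p : Fin q × Fin S.card), A.prediction
      (roundRobin q v i₀) (coinGradient id e (flipCoin (id p) x)) ω (finProdFinEquiv p) =
        A.prediction (roundRobin q v i₀) (coinGradient id e x) ω (finProdFinEquiv p) := by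
    intro ω x p
    -- Each round has its own coin, so flipping it leaves all earlier gradients unchanged.
    refine A.prediction_congr _ ω _ fun s hs => ?_
    obtain ⟨p', rfl⟩ := exists_eq_finProdFinEquiv (hs.trans (finProdFinEquiv p).isLt)
    refine coinGradient_flipCoin id e x p p' fun h => ?_
    rw [id] at h
    rw [h] at hs
    exact lt_irrefl _ hs
  refine Exists.elim (A.exists_expectedRegret_roundRobin_ge hA P v i₀ id e hT
    hflip (fun x => U (b x))
    (S.card * signMeanBound q) ?_)
    fun x hx => ⟨_, _, b x, norm_coinGradient_le id he x, hx⟩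
  have hs (x : Fin q × Fin S.card → Bool) :
      -∑ p : Fin q × Fin S.card, coinSign (x (id p)) * inner ℝ e (U (b x) (v p.2)) =
        ∑ j, |signSum (J j) x| := by
    rw [Fintype.sum_prod_type_right, ← Finset.sum_neg_distrib]
    refine Finset.sum_congr rfl fun j _ => ?_
    simp only [hb, id]
    rw [← Finset.sum_mul]
    have : ∑ k, coinSign (x (k, j)) = signSum (J j) x := by
      simp [signSum, J]
    rw [this, mul_coinSign_oppositeCoin, neg_neg]
  simp only [hs]
  rw [Finset.sum_comm]
  have hJ (j : Fin S.card) : (J j).card = q := by simp [J]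
  have := Finset.sum_le_sum fun j (_ : j ∈ (Finset.univ : Finset (Fin S.card))) =>
    signMeanBound_le (J j)
  simp only [hJ, Finset.sum_const, Finset.card_univ, Fintype.card_fin, nsmul_eq_mul] at this ⊢
  linarith

lemma mem_nbhd {i j : Fin N} : j ∈ nbhd G i ↔ j = i ∨ G.Adj i j := by
  simp [nbhd]

lemma edist_le_one_of_mem_nbhd {i j : Fin N} (h : j ∈ nbhd G i) : G.edist i j ≤ 1 := by
  rcases mem_nbhd.mp h with rfl | h
  · simp
  · exact (SimpleGraph.edist_eq_one_iff_adj.mpr h).le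

lemma IsTimesIndependent.disjoint_nbhd {S : Finset (Fin N)} (hS : IsTimesIndependent G 2 S)
    {i j : Fin N} (hi : i ∈ S) (hj : j ∈ S) (hij : i ≠ j) :
    Disjoint (nbhd G i) (nbhd G j) := by
  refine Finset.disjoint_left.mpr fun k hki hkj => ?_
  have h := (hS i hi j hj hij).trans (G.edist_triangle (v := k))
  have h1 := edist_le_one_of_mem_nbhd hki
  have h2 := edist_le_one_of_mem_nbhd hkj
  rw [SimpleGraph.edist_comm] at h2
  have h3 := h.trans (add_le_add h1 h2)
  rw [show (1 + 1 : ℕ∞) = ((2 : ℕ) : ℕ∞) by norm_num, Nat.cast_le] at h3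
  omega

/-- Agents with disjoint neighbourhoods that face the same random gradients cannot learn from
each other. -/
lemma Algorithm.exists_expectedRegret_synchronous_ge (A : Algorithm G d Ω)
    (hA : A.IsMeasurable) (P : Measure Ω) [IsProbabilityMeasure P] (i₀ : Fin N) {e : Vec d}
    (he : ‖e‖ = 1) {S : Finset (Fin N)} (hS : IsTimesIndependent G 2 S) {T : ℕ}
    (hT : q * S.card ≤ T) :
    ∃ (act : ℕ → Fin N) (g : ℕ → Vec d) (b : Bool), (∀ t, ‖g t‖ ≤ 1) ∧
      S.card * signMeanBound q ≤ A.expectedRegret P act g T fun _ => coinSign b • e := by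
  set v := S.orderEmbOfFin rfl
  set b : (Fin q → Bool) → Bool := fun x => oppositeCoin (signSum Finset.univ x)
  have hflip : ∀ ω (x : Fin q → Bool) (p : Fin q × Fin S.card), A.prediction (roundRobin q v i₀)
      (coinGradient (M := S.card) Prod.fst e (flipCoin (Prod.fst p) x)) ω (finProdFinEquiv p) =
        A.prediction (roundRobin q v i₀) (coinGradient (M := S.card) Prod.fst e x)
          ω (finProdFinEquiv p) := by
    intro ω x p
    refine A.prediction_congr_of_disjoint _ ω _ fun s hs => ?_
    obtain ⟨p', rfl⟩ := exists_eq_finProdFinEquiv (hs.trans (finProdFinEquiv p).isLt)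
    rw [roundRobin_apply, roundRobin_apply]
    -- The coin of `p` may already have been shown to other agents in the same cycle, so causality
    -- is not enough. Earlier activations of the same agent used other coins; those of other agents
    -- have disjoint neighbourhoods.
    by_cases hp : p'.2 = p.2
    · refine Or.inl ⟨by rw [hp], coinGradient_flipCoin Prod.fst e x _ p' fun h => ?_⟩
      rw [Prod.ext h hp] at hs
      exact lt_irrefl _ hs
    · exact Or.inr (hS.disjoint_nbhd (S.orderEmbOfFin_mem rfl _) (S.orderEmbOfFin_mem rfl _)
        fun h => hp (v.injective h))
  refine Exists.elim (A.exists_expectedRegret_roundRobin_ge hA P v i₀ Prod.fst e hT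
    hflip
    (fun x _ => coinSign (b x) • e) (S.card * signMeanBound q) ?_)
    fun x hx => ⟨_, _, b x, norm_coinGradient_le Prod.fst he x, hx⟩
  have hs (x : Fin q → Bool) : -∑ p : Fin q × Fin S.card,
      coinSign (x p.1) * inner ℝ e (coinSign (b x) • e) =
        S.card * |signSum Finset.univ x| := by
    rw [← Finset.sum_mul, Fintype.sum_prod_type, real_inner_smul_right,
      real_inner_self_eq_norm_sq, he]
    simp only [Finset.sum_const, Finset.card_univ, Fintype.card_fin, nsmul_eq_mul]
    rw [← Finset.mul_sum]
    have := mul_coinSign_oppositeCoin (signSum Finset.univ x)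
    simp only [b]
    rw [← neg_neg |_|, ← this, signSum]
    ring
  simp only [hs]
  rw [← Finset.mul_sum]
  have := signMeanBound_le (Finset.univ : Finset (Fin q))
  rw [Finset.card_univ, Fintype.card_fin] at this
  nlinarith [mul_le_mul_of_nonneg_left this (Nat.cast_nonneg (α := ℝ) S.card)]

end RoundRobin
/-! ### Lower bounds with an optimized number of activations -/

section Optimized

lemma le_of_sq_le_sq_of_nonneg {a b : ℝ} (h : a ^ 2 ≤ b ^ 2) (hb : 0 ≤ b) : a ≤ b :=
  (le_abs_self a).trans (abs_le_of_sq_le_sq h hb)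

/-- If there are enough rounds, all `M` agents are activated `T / M` times. Otherwise `T` agents are
activated once each, with regret `T`, and `B ≤ T` concludes. -/
lemma exists_le_mul_signMeanBound {M T : ℕ} (hM : 1 ≤ M) {B : ℝ} (hBT : B ≤ T)
    (hB : B ^ 2 ≤ 2 / 9 * (M * T)) :
    ∃ q M', M' ≤ M ∧ q * M' ≤ T ∧ B ≤ M' * signMeanBound q := by
  rcases le_total T M with h | h
  · exact ⟨1, T, h, by simp, by simpa [signMeanBound] using hBT⟩
  · have hq : 1 ≤ T / M := (Nat.one_le_div_iff hM).mpr h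
    refine ⟨T / M, M, le_rfl, Nat.div_mul_le_self T M, ?_⟩
    refine le_of_sq_le_sq_of_nonneg ?_ (mul_nonneg (Nat.cast_nonneg _) (signMeanBound_nonneg _))
    have hT : (T : ℝ) ≤ M * ((T / M : ℕ) + 1) := by
      exact_mod_cast (Nat.lt_mul_div_succ T hM).le
    have h2 := two_ninths_mul_le_signMeanBound_sq hq
    calc B ^ 2 ≤ 2 / 9 * (M * T) := hB
      _ ≤ 2 / 9 * (M * (M * ((T / M : ℕ) + 1))) := by gcongr
      _ = M ^ 2 * (2 / 9 * ((T / M : ℕ) + 1)) := by ring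
      _ ≤ M ^ 2 * signMeanBound (T / M) ^ 2 := by gcongr
      _ = _ := by ring

lemma exists_norm_eq_one {d : ℕ} (hd : 1 ≤ d) : ∃ e : Vec d, ‖e‖ = 1 :=
  ⟨EuclideanSpace.single ⟨0, hd⟩ 1, by simp⟩

lemma norm_coinSign_smul {d : ℕ} {e : Vec d} (he : ‖e‖ = 1) (b : Bool) :
    ‖coinSign b • e‖ = 1 := by
  rw [norm_smul, Real.norm_eq_abs, abs_coinSign, he, one_mul]

lemma inner_coinSign_smul {d : ℕ} {e : Vec d} (he : ‖e‖ = 1) (b : Bool) :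
    inner ℝ e (coinSign b • e) = coinSign b := by
  rw [real_inner_smul_right, real_inner_self_eq_norm_sq, he]
  ring

variable {N d : ℕ} {G : SimpleGraph (Fin N)} {Ω : Type*} [MeasurableSpace Ω]

lemma Algorithm.exists_le_expectedRegret_independent (A : Algorithm G d Ω)
    (hA : A.IsMeasurable) (P : Measure Ω) [IsProbabilityMeasure P] {e : Vec d}
    (he : ‖e‖ = 1) {S : Finset (Fin N)} (hS : S.Nonempty) {T : ℕ} {B : ℝ} (hBT : B ≤ T)
    (hB : B ^ 2 ≤ 2 / 9 * (S.card * T)) (U : (Fin N → Bool) → Fin N → Vec d)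
    (hU : ∀ b, ∀ i ∈ S, inner ℝ e (U b i) = coinSign (b i)) :
    ∃ (act : ℕ → Fin N) (g : ℕ → Vec d) (b : Fin N → Bool), (∀ t, ‖g t‖ ≤ 1) ∧
      B ≤ A.expectedRegret P act g T (U b) := by
  obtain ⟨q, M, hM, hT, hBM⟩ := exists_le_mul_signMeanBound hS.card_pos hBT hB
  obtain ⟨S', hS', rfl⟩ := Finset.exists_subset_card_eq hM
  obtain ⟨act, g, b, hg, h⟩ := A.exists_expectedRegret_independent_ge hA P hS.choose he S' hT U
    fun b i hi => hU b i (hS' hi)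
  exact ⟨act, g, b, hg, hBM.trans h⟩

lemma Algorithm.exists_le_expectedRegret_synchronous (A : Algorithm G d Ω)
    (hA : A.IsMeasurable) (P : Measure Ω) [IsProbabilityMeasure P] {e : Vec d}
    (he : ‖e‖ = 1) {S : Finset (Fin N)} (hS : S.Nonempty) (hSi : IsTimesIndependent G 2 S)
    {T : ℕ} {B : ℝ} (hBT : B ≤ T) (hB : B ^ 2 ≤ 2 / 9 * (S.card * T)) :
    ∃ (act : ℕ → Fin N) (g : ℕ → Vec d) (b : Bool), (∀ t, ‖g t‖ ≤ 1) ∧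
      B ≤ A.expectedRegret P act g T fun _ => coinSign b • e := by
  obtain ⟨q, M, hM, hT, hBM⟩ := exists_le_mul_signMeanBound hS.card_pos hBT hB
  obtain ⟨S', hS', rfl⟩ := Finset.exists_subset_card_eq hM
  obtain ⟨act, g, b, hg, h⟩ := A.exists_expectedRegret_synchronous_ge hA P hS.choose he
    (fun i hi j hj => hSi i (hS' hi) j (hS' hj)) hT
  exact ⟨act, g, b, hg, hBM.trans h⟩

end Optimized

/-! ### Comparator variances -/

section Variance

variable {N d : ℕ}

lemma sum_norm_sub_mean_sq_le (U : Fin N → Vec d) :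
    ∑ i, ‖U i - (1 / (N : ℝ)) • ∑ j, U j‖ ^ 2 ≤ ∑ i, ‖U i‖ ^ 2 := by
  set m := (1 / (N : ℝ)) • ∑ j, U j with hm
  have hs : ∑ j, U j = (N : ℝ) • m := by
    rcases Nat.eq_zero_or_pos N with rfl | hN
    · simp
    · rw [hm, smul_smul, mul_one_div_cancel (by positivity), one_smul]
  have h : ∑ i, ‖U i - m‖ ^ 2 = ∑ i, ‖U i‖ ^ 2 - N * ‖m‖ ^ 2 := by
    simp only [norm_sub_sq_real, Finset.sum_add_distrib, Finset.sum_sub_distrib,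
      ← Finset.mul_sum, ← sum_inner, hs, real_inner_smul_left, real_inner_self_eq_norm_sq]
    simp
    ring
  rw [h]
  linarith [show 0 ≤ N * ‖m‖ ^ 2 by positivity]

lemma variance_le (U : Fin N → Vec d) {ν : ℝ} (hN : 1 ≤ N)
    (h : ∑ i, ‖U i‖ ^ 2 ≤ ν ^ 2 * ((N : ℝ) - 1)) : variance U ≤ ν ^ 2 := by
  unfold variance
  have hN' : (0 : ℝ) ≤ (N : ℝ) - 1 := sub_nonneg.mpr (by exact_mod_cast hN)
  -- For `N = 1` the prefactor is `1 / 0 = 0`.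
  rcases hN'.eq_or_lt with h0 | h0
  · rw [← h0]
    simp only [div_zero, zero_mul]
    positivity
  · rw [one_div, inv_mul_le_iff₀ h0, mul_comm]
    exact (sum_norm_sub_mean_sq_le U).trans h

lemma variance_const (hN : 1 ≤ N) (w : Vec d) : variance (fun _ : Fin N => w) = 0 := by
  have : (N : ℝ) ≠ 0 := by positivity
  simp [variance, ← Nat.cast_smul_eq_nsmul ℝ, smul_smul, this]

lemma sum_sum_norm_sub_sq_le (S : Finset (Fin N)) (U : Fin N → Vec d) :
    ∑ i ∈ S, ∑ i' ∈ S, ‖U i - U i'‖ ^ 2 ≤ 2 * S.card * ∑ i ∈ S, ‖U i‖ ^ 2 := by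
  have h : ∑ i ∈ S, ∑ i' ∈ S, ‖U i - U i'‖ ^ 2 =
      2 * S.card * ∑ i ∈ S, ‖U i‖ ^ 2 - 2 * ‖∑ i ∈ S, U i‖ ^ 2 := by
    simp only [norm_sub_sq_real, Finset.sum_add_distrib, Finset.sum_sub_distrib,
      ← Finset.mul_sum, ← inner_sum, ← sum_inner, real_inner_self_eq_norm_sq,
      Finset.sum_const, nsmul_eq_mul]
    ring
  rw [h]
  linarith [sq_nonneg ‖∑ i ∈ S, U i‖]

/-- The comparator with rows `±e` on `S`, with signs given by coins, and `0` elsewhere. -/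
noncomputable def sparseComparator (S : Finset (Fin N)) (e : Vec d) (b : Fin N → Bool)
    (i : Fin N) : Vec d :=
  if i ∈ S then coinSign (b i) • e else 0

lemma norm_sparseComparator_sq (S : Finset (Fin N)) {e : Vec d} (he : ‖e‖ = 1)
    (b : Fin N → Bool) (i : Fin N) :
    ‖sparseComparator S e b i‖ ^ 2 = if i ∈ S then 1 else 0 := by
  unfold sparseComparator
  split_ifs
  · rw [norm_coinSign_smul he, one_pow]
  · simp

lemma sparseComparator_mem (S : Finset (Fin N)) {e : Vec d} (he : ‖e‖ = 1)
    (b : Fin N → Bool) : sparseComparator S e b ∈ comparators N d := fun i => by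
  unfold sparseComparator
  split_ifs
  · exact (norm_coinSign_smul he _).le
  · simp

lemma inner_sparseComparator {S : Finset (Fin N)} {e : Vec d} (he : ‖e‖ = 1)
    (b : Fin N → Bool) {i : Fin N} (hi : i ∈ S) :
    inner ℝ e (sparseComparator S e b i) = coinSign (b i) := by
  rw [sparseComparator, if_pos hi, inner_coinSign_smul he]

end Variance

/-! ### General graphs -/

section General

variable {N d : ℕ} {G : SimpleGraph (Fin N)} {Ω : Type*} [MeasurableSpace Ω]

lemma exists_card_eq_timesIndepNum (G : SimpleGraph (Fin N)) (k : ℕ) :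
    ∃ S : Finset (Fin N), IsTimesIndependent G k S ∧ S.card = timesIndepNum G k := by
  refine Nat.sSup_mem (s := {n | ∃ S : Finset (Fin N), IsTimesIndependent G k S ∧ S.card = n})
    ⟨0, ∅, by simp [IsTimesIndependent], rfl⟩ ⟨N, ?_⟩
  rintro n ⟨S, -, rfl⟩
  simpa using S.card_le_univ

lemma one_le_timesIndepNum (hN : 1 ≤ N) (G : SimpleGraph (Fin N)) (k : ℕ) :
    1 ≤ timesIndepNum G k := by
  refine le_csSup ⟨N, ?_⟩ ⟨{⟨0, hN⟩}, ?_, rfl⟩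
  · rintro n ⟨S, -, rfl⟩
    simpa using S.card_le_univ
  · intro i hi j hj hij
    rw [Finset.mem_singleton] at hi hj
    exact absurd (hi.trans hj.symm) hij

lemma Algorithm.exists_le_expectedRegret_of_variance (A : Algorithm G d Ω)
    (hA : A.IsMeasurable) (P : Measure Ω) [IsProbabilityMeasure P] (hN : 1 ≤ N) {e : Vec d}
    (he : ‖e‖ = 1) {ν : ℝ} {T : ℕ} (hν : ν ^ 2 * ((N : ℝ) - 1) ≤ N) {B : ℝ}
    (hBT : B ≤ T) (hB : B ^ 2 = (1 + ν ^ 2 * ((N : ℝ) - 1)) * T / 9) :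
    ∃ (act : ℕ → Fin N) (g : ℕ → Vec d), (∀ t, ‖g t‖ ≤ 1) ∧
      ∃ U ∈ comparators N d, variance U ≤ ν ^ 2 ∧ B ≤ A.expectedRegret P act g T U := by
  have hT : (0 : ℝ) ≤ T := Nat.cast_nonneg T
  rcases lt_or_ge (ν ^ 2 * ((N : ℝ) - 1)) 2 with hV | hV
  -- One agent, active in all `T` rounds, suffices: here `B² ≤ T / 3`. The comparator copies its
  -- sign to everyone, so its variance is zero.
  · obtain ⟨act, g, b, hg, h⟩ := A.exists_expectedRegret_independent_ge (q := T) hA P ⟨0, hN⟩ he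
      {⟨0, hN⟩} (T := T) (by simp) (fun b _ => coinSign (b ⟨0, hN⟩) • e) (fun b i hi => by
        rw [Finset.mem_singleton.mp hi, inner_coinSign_smul he])
    refine ⟨act, g, hg, _, fun i => (norm_coinSign_smul he _).le, ?_, le_trans ?_ h⟩
    · rw [variance_const hN]
      positivity
    · rw [Finset.card_singleton, Nat.cast_one, one_mul]
      refine le_of_sq_le_sq_of_nonneg (le_trans ?_ (div_three_le_signMeanBound_sq T))
        (signMeanBound_nonneg T)
      rw [hB]
      nlinarith
  · have h0 : 0 ≤ ν ^ 2 * ((N : ℝ) - 1) := by linarith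
    obtain ⟨S, -, hS⟩ := Finset.exists_subset_card_eq (s := (Finset.univ : Finset (Fin N)))
      (n := ⌊ν ^ 2 * ((N : ℝ) - 1)⌋₊) (by
        rw [Finset.card_univ, Fintype.card_fin]
        exact Nat.floor_le_of_le hν)
    have hf2 : 2 ≤ S.card := hS ▸ Nat.le_floor (by exact_mod_cast hV)
    have hf2' : (2 : ℝ) ≤ S.card := by exact_mod_cast hf2
    have hf : ν ^ 2 * ((N : ℝ) - 1) < S.card + 1 := hS ▸ Nat.lt_floor_add_one _
    -- Since `S.card ≥ 2`, `1 + ν² (N - 1) < S.card + 2 ≤ 2 * S.card`; this is where `1 / 9` meets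
    -- `2 / 9`.
    obtain ⟨act, g, b, hg, h⟩ := A.exists_le_expectedRegret_independent hA P he
      (Finset.card_pos.mp (by omega : 0 < S.card)) hBT (by rw [hB]; nlinarith)
      (sparseComparator S e) (fun b i hi => inner_sparseComparator he b hi)
    refine ⟨act, g, hg, _, sparseComparator_mem S he b, variance_le _ hN ?_, h⟩
    simp only [norm_sparseComparator_sq S he]
    rw [Finset.sum_ite_mem, Finset.univ_inter, Finset.sum_const, nsmul_one, hS]
    exact Nat.floor_le h0

lemma Algorithm.exists_generalBound_le (A : Algorithm G d Ω)
    (hA : A.IsMeasurable) (P : Measure Ω) [IsProbabilityMeasure P] (hN : 1 ≤ N) (hd : 1 ≤ d)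
    {ν : ℝ} {T : ℕ} (hν : ν ^ 2 * ((N : ℝ) - 1) ≤ N)
    (hBT : generalBound N (timesIndepNum G 2) ν T ≤ T) :
    ∃ (act : ℕ → Fin N) (g : ℕ → Vec d), (∀ t, ‖g t‖ ≤ 1) ∧
      ∃ U ∈ comparators N d, variance U ≤ ν ^ 2 ∧
        generalBound N (timesIndepNum G 2) ν T ≤ A.expectedRegret P act g T U := by
  obtain ⟨e, he⟩ := exists_norm_eq_one hd
  have hN' : (0 : ℝ) ≤ (N : ℝ) - 1 := sub_nonneg.mpr (by exact_mod_cast hN)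
  unfold generalBound at hBT ⊢
  rcases max_choice (Real.sqrt (1 + ν ^ 2 * ((N : ℝ) - 1)))
    (Real.sqrt (timesIndepNum G 2 : ℝ)) with h | h
  · rw [h] at hBT ⊢
    refine A.exists_le_expectedRegret_of_variance hA P hN he hν hBT ?_
    rw [mul_pow, div_pow, Real.sq_sqrt (by positivity), Real.sq_sqrt (by positivity)]
    ring
  · rw [h] at hBT ⊢
    obtain ⟨S, hS, hSc⟩ := exists_card_eq_timesIndepNum G 2
    obtain ⟨act, g, b, hg, h⟩ := A.exists_le_expectedRegret_synchronous hA P he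
      (Finset.card_pos.mp (hSc ▸ one_le_timesIndepNum hN G 2)) hS hBT (by
        rw [mul_pow, div_pow, Real.sq_sqrt (by positivity), Real.sq_sqrt (by positivity), hSc]
        have : (0 : ℝ) ≤ timesIndepNum G 2 * T := by positivity
        linarith)
    refine ⟨act, g, hg, _, fun i => (norm_coinSign_smul he _).le, ?_, h⟩
    rw [variance_const hN]
    positivity

end General
/-! ### Disjoint unions of cliques -/

section Cliques

variable {m K d : ℕ}

/-- The clique that contains agent `i`, among `m` cliques of size `K + 1`. -/
def cliqueOf (i : Fin (m * (K + 1))) : Fin m := (finProdFinEquiv.symm i).1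

/-- The position of agent `i` in its clique. -/
def rankOf (i : Fin (m * (K + 1))) : Fin (K + 1) := (finProdFinEquiv.symm i).2

lemma cliqueOf_finProdFinEquiv (p : Fin m × Fin (K + 1)) :
    cliqueOf (finProdFinEquiv p) = p.1 := by
  rw [cliqueOf, Equiv.symm_apply_apply]

lemma rankOf_finProdFinEquiv (p : Fin m × Fin (K + 1)) : rankOf (finProdFinEquiv p) = p.2 := by
  rw [rankOf, Equiv.symm_apply_apply]

lemma finProdFinEquiv_cliqueOf_rankOf (i : Fin (m * (K + 1))) :
    finProdFinEquiv (cliqueOf i, rankOf i) = i :=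
  finProdFinEquiv.apply_symm_apply i

/-- The disjoint union of `m` cliques of size `K + 1`. -/
def cliqueUnion (m K : ℕ) : SimpleGraph (Fin (m * (K + 1))) where
  Adj i j := i ≠ j ∧ cliqueOf i = cliqueOf j
  symm := ⟨fun _ _ h => ⟨h.1.symm, h.2.symm⟩⟩
  loopless := ⟨fun _ h => h.1 rfl⟩

lemma mem_nbhd_cliqueUnion {i j : Fin (m * (K + 1))} :
    j ∈ nbhd (cliqueUnion m K) i ↔ cliqueOf j = cliqueOf i := by
  rw [mem_nbhd]
  change j = i ∨ (i ≠ j ∧ cliqueOf i = cliqueOf j) ↔ _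
  constructor
  · rintro (rfl | h)
    · rfl
    · exact h.2.symm
  · intro h
    by_cases hij : j = i
    · exact Or.inl hij
    · exact Or.inr ⟨Ne.symm hij, h.symm⟩

lemma sum_nbhd_cliqueUnion (i : Fin (m * (K + 1))) (F : Fin (m * (K + 1)) → ℝ) :
    ∑ j ∈ nbhd (cliqueUnion m K) i, F j =
      ∑ k : Fin (K + 1), F (finProdFinEquiv (cliqueOf i, k)) := by
  have h : nbhd (cliqueUnion m K) i = Finset.univ.filter fun j => cliqueOf j = cliqueOf i := by
    ext j
    simp [mem_nbhd_cliqueUnion]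
  rw [h, Finset.sum_filter, ← finProdFinEquiv.sum_comp, Fintype.sum_prod_type_right]
  refine Finset.sum_congr rfl fun k _ => ?_
  simp [cliqueOf_finProdFinEquiv]

lemma card_nbhd_cliqueUnion (i : Fin (m * (K + 1))) :
    (nbhd (cliqueUnion m K) i).card = K + 1 := by
  have h := sum_nbhd_cliqueUnion i fun _ => 1
  simp only [Finset.sum_const, nsmul_one, Finset.card_univ, Fintype.card_fin] at h
  exact_mod_cast h

lemma isRegularOfDegree_cliqueUnion [DecidableRel (cliqueUnion m K).Adj] :
    (cliqueUnion m K).IsRegularOfDegree K := by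
  intro i
  have h : (cliqueUnion m K).neighborFinset i = (nbhd (cliqueUnion m K) i).erase i := by
    ext j
    rw [SimpleGraph.mem_neighborFinset, Finset.mem_erase, mem_nbhd]
    exact ⟨fun h => ⟨h.1.symm, Or.inr h⟩, fun h => h.2.resolve_left h.1⟩
  rw [← SimpleGraph.card_neighborFinset_eq_degree, h,
    Finset.card_erase_of_mem (mem_nbhd.mpr (Or.inl rfl)), card_nbhd_cliqueUnion]
  rfl

/-- The first `f` agents of each clique. -/
def leaders (m K f : ℕ) : Finset (Fin (m * (K + 1))) :=
  Finset.univ.filter fun i => (rankOf i : ℕ) < f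

lemma card_filter_val_lt {f : ℕ} (hf : f ≤ K + 1) :
    (Finset.univ.filter fun k : Fin (K + 1) => (k : ℕ) < f).card = f := by
  rw [Fin.card_filter_val_lt, min_eq_right hf]

lemma card_leaders {f : ℕ} (hf : f ≤ K + 1) : (leaders m K f).card = m * f := by
  rw [leaders, Finset.card_filter, ← finProdFinEquiv.sum_comp, Fintype.sum_prod_type]
  simp [rankOf_finProdFinEquiv, card_filter_val_lt hf]

lemma localVariance_cliqueUnion_eq_zero (U : Fin (m * (K + 1)) → Vec d)
    (hU : ∀ i j, cliqueOf i = cliqueOf j → U i = U j) (j : Fin (m * (K + 1))) :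
    localVariance (cliqueUnion m K) U j = 0 := by
  unfold localVariance
  rw [Finset.sum_eq_zero, mul_zero]
  refine fun i hi => Finset.sum_eq_zero fun i' hi' => ?_
  rw [mem_nbhd_cliqueUnion] at hi hi'
  rw [hU i i' (hi.trans hi'.symm), sub_self, norm_zero, zero_pow two_ne_zero]

lemma localVariance_sparseComparator_le {f : ℕ} (hf : f ≤ K + 1) (hK : 0 < K) {e : Vec d}
    (he : ‖e‖ = 1) (b : Fin (m * (K + 1)) → Bool) (j : Fin (m * (K + 1))) :
    localVariance (cliqueUnion m K) (sparseComparator (leaders m K f) e b) j ≤ f / K := by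
  have h := sum_sum_norm_sub_sq_le (nbhd (cliqueUnion m K) j)
    (sparseComparator (leaders m K f) e b)
  have hs : ∑ i ∈ nbhd (cliqueUnion m K) j, ‖sparseComparator (leaders m K f) e b i‖ ^ 2 = f := by
    simp only [norm_sparseComparator_sq _ he]
    rw [sum_nbhd_cliqueUnion]
    simp only [leaders, Finset.mem_filter, Finset.mem_univ, true_and,
      rankOf_finProdFinEquiv]
    rw [← Finset.sum_filter, Finset.sum_const, nsmul_one, card_filter_val_lt hf]
  have hK' : (0 : ℝ) < K := by exact_mod_cast hK
  unfold localVariance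
  rw [hs] at h
  rw [card_nbhd_cliqueUnion] at h ⊢
  push_cast at h ⊢
  rw [add_sub_cancel_right]
  calc _ ≤ 1 / (2 * ((K : ℝ) + 1) * K) * (2 * (K + 1) * f) := by gcongr
    _ = f / K := by field_simp

variable {Ω : Type*} [MeasurableSpace Ω]

lemma Algorithm.exists_le_expectedRegret_cliqueUnion (A : Algorithm (cliqueUnion m K) d Ω)
    (hA : A.IsMeasurable) (P : Measure Ω) [IsProbabilityMeasure P] (hm : 1 ≤ m) (hK : 2 ≤ K)
    (hd : 1 ≤ d) {s : ℝ} {T : ℕ} (hs : 0 ≤ s) (hsK : (K : ℝ) * s ≤ K + 1) {B : ℝ}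
    (hBT : B ≤ T) (hB : B ^ 2 ≤ 3 / 50 * ((1 + K * s) * (m * T))) :
    ∃ (act : ℕ → Fin (m * (K + 1))) (g : ℕ → Vec d), (∀ t, ‖g t‖ ≤ 1) ∧
      ∃ U ∈ comparators (m * (K + 1)) d, (∀ j, localVariance (cliqueUnion m K) U j ≤ s) ∧
        B ≤ A.expectedRegret P act g T U := by
  obtain ⟨e, he⟩ := exists_norm_eq_one hd
  have hmT : (0 : ℝ) ≤ m * T := by positivity
  have hK' : (0 : ℝ) < K := by exact_mod_cast (by omega : 0 < K)
  rcases lt_or_ge ((K : ℝ) * s) 2 with hV | hV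
  · have hc := card_leaders (m := m) (K := K) (f := 1) (by omega)
    -- There are `m` leaders, and `3 / 50 * 3 ≤ 2 / 9`. Every agent copies the sign of its leader,
    -- so all local variances vanish.
    obtain ⟨act, g, b, hg, h⟩ := A.exists_le_expectedRegret_independent hA P he
      (S := leaders m K 1) (Finset.card_pos.mp (by omega)) hBT
      (by
        rw [hc, mul_one]
        nlinarith)
      (fun b i => coinSign (b (finProdFinEquiv (cliqueOf i, 0))) • e) (fun b i hi => by
        have hr : rankOf i = 0 := by
          have : (rankOf i : ℕ) < 1 := by simpa [leaders] using hi
          exact Fin.ext (by simpa using this)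
        rw [← hr, inner_coinSign_smul he, finProdFinEquiv_cliqueOf_rankOf])
    refine ⟨act, g, hg, _, fun i => (norm_coinSign_smul he _).le, fun j => ?_, h⟩
    rw [localVariance_cliqueUnion_eq_zero _ fun i j hij => by simp only [hij]]
    exact hs
  · set f := ⌊(K : ℝ) * s⌋₊ with hf
    have h0 : 0 ≤ (K : ℝ) * s := by linarith
    have hf2 : 2 ≤ f := Nat.le_floor (by exact_mod_cast hV)
    have hf2' : (2 : ℝ) ≤ f := by exact_mod_cast hf2
    have hfK : f ≤ K + 1 := Nat.floor_le_of_le (by exact_mod_cast hsK)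
    have hlt : (K : ℝ) * s < f + 1 := Nat.lt_floor_add_one _
    have hc := card_leaders (m := m) hfK
    -- There are `m * f` leaders, and `1 + K s < f + 2 ≤ 2 * f`.
    obtain ⟨act, g, b, hg, h⟩ := A.exists_le_expectedRegret_independent hA P he
      (S := leaders m K f) (Finset.card_pos.mp (by rw [hc]; positivity)) hBT
      (by
        rw [hc]
        push_cast
        nlinarith)
      (sparseComparator _ e) (fun b i hi => inner_sparseComparator he b hi)
    refine ⟨act, g, hg, _, sparseComparator_mem _ he b, fun j => ?_, h⟩
    refine (localVariance_sparseComparator_le hfK (by omega) he b j).trans ?_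
    rw [div_le_iff₀ hK', mul_comm]
    exact Nat.floor_le h0

lemma regularBound_mono {N T : ℕ} {s s' : ℝ} (h : s ≤ s') :
    regularBound N K s T ≤ regularBound N K s' T := by
  unfold regularBound
  gcongr

/-- For `K ≥ 2`, `(K + 1) / K ≤ 3 / 2`, and `1 / 25 * (3 / 2) = 3 / 50`. -/
lemma regularBound_sq_le (hK : 2 ≤ K) {s : ℝ} (hs : 0 ≤ s) (T : ℕ) :
    regularBound (m * (K + 1)) K s T ^ 2 ≤ 3 / 50 * ((1 + K * s) * (m * T)) := by
  have hK' : (2 : ℝ) ≤ K := by exact_mod_cast hK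
  have h : ((m * (K + 1) : ℕ) : ℝ) * T / K ≤ 3 / 2 * (m * T) := by
    rw [div_le_iff₀ (by linarith)]
    push_cast
    nlinarith [show (0 : ℝ) ≤ m * T by positivity]
  unfold regularBound
  rw [mul_pow, mul_pow, Real.sq_sqrt (by positivity), Real.sq_sqrt (by positivity)]
  have := mul_le_mul_of_nonneg_left h (show 0 ≤ 1 + (K : ℝ) * s by positivity)
  linarith

end Cliques
end CommOCO

theorem mainTheorem3 :
    (∀ (N d : ℕ), 1 ≤ N → 1 ≤ d → ∀ (G : SimpleGraph (Fin N)) (ν : ℝ) (T : ℕ),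
      0 ≤ ν → ν ^ 2 * ((N : ℝ) - 1) ≤ (N : ℝ) →
      generalBound N (timesIndepNum G 2) ν T ≤ (T : ℝ) →
      ∀ (Ω : Type u) [MeasurableSpace Ω] (P : Measure Ω) [IsProbabilityMeasure P]
        (A : Algorithm.{u, v} G d Ω), A.IsMeasurable →
        ∃ (act : ℕ → Fin N) (g : ℕ → Vec d), (∀ t, ‖g t‖ ≤ 1) ∧
          ∃ U ∈ comparators N d, variance U ≤ ν ^ 2 ∧
            generalBound N (timesIndepNum G 2) ν T ≤ A.expectedRegret P act g T U) ∧
    (∀ K : ℕ, Even K → 0 < K → ∀ n : ℕ, ∃ N : ℕ, n ≤ N ∧ 1 ≤ N ∧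
      ∃ (G : SimpleGraph (Fin N)) (_ : DecidableRel G.Adj), G.IsRegularOfDegree K ∧
        ∀ (d : ℕ), 1 ≤ d → ∀ (s : ℝ) (T : ℕ),
          0 ≤ s → (K : ℝ) * s ≤ (K : ℝ) + 1 → regularBound N K s T ≤ (T : ℝ) →
          ∀ (Ω : Type u) [MeasurableSpace Ω] (P : Measure Ω) [IsProbabilityMeasure P]
            (A : Algorithm.{u, v} G d Ω), A.IsMeasurable →
            ∃ (act : ℕ → Fin N) (g : ℕ → Vec d), (∀ t, ‖g t‖ ≤ 1) ∧
              ∃ U ∈ comparators N d, maxLocalVariance G U ≤ s ∧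
                regularBound N K s T ≤ A.expectedRegret P act g T U ∧
                regularBound N K (minLocalVariance G U) T ≤ A.expectedRegret P act g T U) := by
  refine ⟨fun N d hN hd G ν T _ hν hBT Ω _ P _ A hA =>
    A.exists_generalBound_le hA P hN hd hν hBT, fun K hKe hK n => ?_⟩
  have hK2 : 2 ≤ K := by
    obtain ⟨k, rfl⟩ := hKe
    omega
  have hN : 1 ≤ (n + 1) * (K + 1) := Nat.mul_pos n.succ_pos K.succ_pos
  refine ⟨(n + 1) * (K + 1), by nlinarith, hN, cliqueUnion (n + 1) K, Classical.decRel _, ?_, ?_⟩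
  · classical exact isRegularOfDegree_cliqueUnion
  · intro d hd s T hs hsK hBT Ω _ P _ A hA
    obtain ⟨act, g, hg, U, hU, hUs, h⟩ := A.exists_le_expectedRegret_cliqueUnion hA P
      (Nat.succ_pos n) hK2 hd hs hsK hBT (regularBound_sq_le hK2 hs T)
    have j₀ : Fin ((n + 1) * (K + 1)) := ⟨0, hN⟩
    have : Nonempty (Fin ((n + 1) * (K + 1))) := ⟨j₀⟩
    -- The bound increases with the variance level, and the smallest local variance of `U` is at
    -- most `s`.
    refine ⟨act, g, hg, U, hU, ciSup_le hUs, h, (regularBound_mono ?_).trans h⟩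
    exact (ciInf_le (Set.finite_range _).bddBelow j₀).trans (hUs j₀)
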